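/- Conventions. A distance space $(X,d)$ is a set $X$ with a function $d\colon X\times X\to[0,\infty)$ such that $d(x,x)=0$ for all $x\in X$ (no other axioms). Let $B_d(x,r)=\{z\in X\colon d(x,z)<r\}$; a set $E\subset X$ is open if for every $x\in E$ there is $r>0$ with $B_d(x,r)\subset E$. The space $(X,d)$ is well-behaved if $x\in\mathrm{Int}(B_d(x,r))$ for all $x\in X$ and $r>0$. The complete oriented graph $\Gamma(X)$ consists of the vertices $x\in X$ and of the points $(x,y,t)$ with $x,y\in X$, $x\neq y$, $t\in(0,1)$; for $x\ne y$ the oriented edge $[x,y]$ is $\{x,y\}\cup\{(x,y,t)\colon t\in(0,1)\}$. On each edge $[x,y]$ let $r$ be the Euclidean distance obtained by identifying $[x,y]$ with $[0,1]$ via $x\mapsto 0$, $(x,y,t)\mapsto t$, $y\mapsto 1$. For $a,b\in\Gamma(X)$ let $\rho(a,b)$ be the infimum of the sums $\sum_{i=1}^n r(a_{i-1},a_i)$ over $n\ge 0$ and all finite chains $a=a_0,a_1,\dots,a_n=b$ in $\Gamma(X)$ whose consecutive points lie on a common edge; $\rho$ is a metric. Put $d_1=\min\{d,1/2\}$ and,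 for $a\in X$, $$Z_a=\{a\}\cup\bigcup_{b\in X\setminus\{a\}}\{z\in[a,b]\setminus\{b\}\colon\rho(a,z)\le 1-d_1(b,a)\}.$$ The cobweb is the metric space $\mathsf{Cob}(X,d)=\bigcup_{a\in X}Z_a$ with the metric induced from $\rho$. The sets $Z_a$ are pairwise disjoint, and the compression map $\pi\colon\mathsf{Cob}(X,d)\to X$ is given by $\pi(Z_a)=\{a\}$. Let $\mathsf{Cob}^0(X,d)=(X,d)$ and $\mathsf{Cob}^{n+1}(X,d)=\mathsf{Cob}(\mathsf{Cob}^n(X,d))$, where for $n\ge1$ the space $\mathsf{Cob}^n(X,d)$ carries its cobweb metric, and let $\pi^{n+1}_n\colon\mathsf{Cob}^{n+1}(X,d)\to\mathsf{Cob}^n(X,d)$ be the compression maps. Let $$\mathsf{Cob}^\omega(X,d)=\Big\{(x_n)_{n\ge1}\in\prod_{n\ge1}\mathsf{Cob}^n(X,d)\colon \pi^{n+1}_n(x_{n+1})=x_n\text{ for all }n\ge1\Big\}$$ be the inverse limit, with the subspace topology of the product topology, and let the limit compression map $\pi^\omega_0\colon\mathsf{Cob}^\omega(X,d)\to X$ be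 $\pi^\omega_0\big((x_n)_{n\ge1}\big)=\pi^1_0(x_1)$. A map $f\colon Y\to Z$ of topological spaces is monotone if every fiber $f^{-1}(z)$, $z\in Z$, is connected; quotient if $A\subset Z$ is open whenever $f^{-1}(A)$ is open in $Y$; and hereditarily quotient if for every $z\in Z$ and every open $U\subset Y$ with $f^{-1}(z)\subset U$ one has $z\in\mathrm{Int}(f(U))$. Theorem. For every distance space $(X,d)$, the limit compression map $\pi^\omega_0\colon\mathsf{Cob}^\omega(X,d)\to X$ is a continuous, monotone, quotient surjection. Moreover, $\pi^\omega_0$ is hereditarily quotient if and only if $(X,d)$ is well-behaved. -/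

import Mathlib

universe u

/-- A distance space: a set `X` with a function `d : X × X → [0, ∞)` vanishing on the diagonal
(no symmetry, separation or triangle inequality is required). -/
structure DistanceSpace : Type (u + 1) where
  carrier : Type u
  d : carrier → carrier → ℝ
  d_nonneg : ∀ x y, 0 ≤ d x y
  d_self : ∀ x, d x x = 0

namespace DistanceSpace

instance : CoeSort DistanceSpace.{u} (Type u) := ⟨DistanceSpace.carrier⟩

/-- The ball `B_d(x, r) = {z | d(x, z) < r}`. -/
def ball (X : DistanceSpace.{u}) (x : X) (r : ℝ) : Set X := {z | X.d x z < r}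

/-- The topology generated by the distance function: `E` is open iff every `x ∈ E` has a ball
centered at `x` and contained in `E`. For a metric this is the metric topology. -/
instance instTopologicalSpaceCarrier (X : DistanceSpace.{u}) : TopologicalSpace X where
  IsOpen E := ∀ x ∈ E, ∃ r : ℝ, 0 < r ∧ X.ball x r ⊆ E
  isOpen_univ := fun _ _ => ⟨1, one_pos, Set.subset_univ _⟩
  isOpen_inter := by
    intro s t hs ht x hx
    obtain ⟨r, hr, hrs⟩ := hs x hx.1
    obtain ⟨q, hq, hqt⟩ := ht x hx.2
    refine ⟨min r q, lt_min hr hq, fun z hz => ⟨hrs ?_, hqt ?_⟩⟩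
    · exact lt_of_lt_of_le (show X.d x z < min r q from hz) (min_le_left _ _)
    · exact lt_of_lt_of_le (show X.d x z < min r q from hz) (min_le_right _ _)
  isOpen_sUnion := by
    intro S hS x hx
    obtain ⟨s, hs, hxs⟩ := hx
    obtain ⟨r, hr, hrs⟩ := hS s hs x hxs
    exact ⟨r, hr, hrs.trans (Set.subset_sUnion_of_mem hs)⟩

/-- A distance space is well-behaved if every ball is a neighbourhood of its center. -/
def WellBehaved (X : DistanceSpace.{u}) : Prop :=
  ∀ (x : X) (r : ℝ), 0 < r → x ∈ interior (X.ball x r)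

end DistanceSpace

/-- The complete oriented graph `Γ(X)`: the vertices `x ∈ X` and the inner points `(x, y, t)`,
`0 < t < 1`, of the oriented edges `[x, y]`, `x ≠ y`. -/
inductive OrientedGraph (X : Type u) : Type u where
  | vertex (x : X) : OrientedGraph X
  | edgePt (x y : X) (hxy : x ≠ y) (t : ℝ) (ht : t ∈ Set.Ioo (0 : ℝ) 1) : OrientedGraph X

namespace OrientedGraph

variable {X : Type u}

/-- The oriented edge `[x, y] = {x, y} ∪ {(x, y, t) | t ∈ (0, 1)}`. -/
def edge (x y : X) : Set (OrientedGraph X) :=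
  {vertex x, vertex y} ∪ {z | ∃ hxy t ht, z = edgePt x y hxy t ht}

/-- Two points lie on a common edge `[x, y]` with distinct ends. -/
def SameEdge (a b : OrientedGraph X) : Prop :=
  ∃ x y : X, x ≠ y ∧ a ∈ edge x y ∧ b ∈ edge x y

open Classical in
/-- The Euclidean distance `r(a, b)` of two points of a common edge. The value is meaningful (and
used) only when `SameEdge a b`. -/
noncomputable def edgeDist : OrientedGraph X → OrientedGraph X → ℝ
  | vertex x, vertex y => if x = y then 0 else 1
  | vertex z, edgePt x _ _ t _ => if z = x then t else 1 - t
  | edgePt x _ _ t _, vertex z => if z = x then t else 1 - t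
  | edgePt _ _ _ t _, edgePt _ _ _ s _ => |t - s|

theorem edgeDist_nonneg (a b : OrientedGraph X) : 0 ≤ edgeDist a b := by
  rcases a with x | ⟨x, y, h, t, ht⟩ <;> rcases b with x' | ⟨x', y', h', s, hs⟩ <;>
    simp only [edgeDist]
  · split_ifs <;> norm_num
  · split_ifs <;> linarith [hs.1, hs.2]
  · split_ifs <;> linarith [ht.1, ht.2]
  · exact abs_nonneg _

/-- The lengths of the finite chains `a = c 0, c 1, …, c n = b` in `Γ(X)` whose consecutive points
lie on a common edge. -/
def chainLengths (a b : OrientedGraph X) : Set ℝ :=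
  {L | ∃ (n : ℕ) (c : ℕ → OrientedGraph X), c 0 = a ∧ c n = b ∧
    (∀ i < n, SameEdge (c i) (c (i + 1))) ∧
    L = ∑ i ∈ Finset.range n, edgeDist (c i) (c (i + 1))}

/-- The path metric `ρ` of `Γ(X)`: the infimum of the lengths of the chains from `a` to `b`. -/
noncomputable def rho (a b : OrientedGraph X) : ℝ := sInf (chainLengths a b)

theorem chainLengths_nonneg (a b : OrientedGraph X) : ∀ L ∈ chainLengths a b, 0 ≤ L := by
  rintro L ⟨n, c, -, -, -, rfl⟩
  exact Finset.sum_nonneg fun i _ => edgeDist_nonneg _ _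

theorem rho_nonneg (a b : OrientedGraph X) : 0 ≤ rho a b :=
  Real.sInf_nonneg (chainLengths_nonneg a b)

theorem rho_self (a : OrientedGraph X) : rho a a = 0 := by
  refine le_antisymm (csInf_le ⟨0, chainLengths_nonneg a a⟩ ?_) (rho_nonneg a a)
  exact ⟨0, fun _ => a, rfl, rfl, by simp, by simp⟩

/-- The vertex at which the half-open edge containing a point starts:
`x ↦ x` and `(x, y, t) ↦ x`. -/
def start : OrientedGraph X → X
  | vertex x => x
  | edgePt x _ _ _ _ => x

end OrientedGraph

namespace DistanceSpace

open OrientedGraph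

/-- The arc `[a, a_b] = {z ∈ [a, b] | ρ(a, z) ≤ 1 - d₁(b, a)}`, where `d₁ = min {d, 1/2}`. -/
def arc (X : DistanceSpace.{u}) (a b : X) : Set (OrientedGraph X) :=
  {z | z ∈ edge a b ∧ rho (vertex a) z ≤ 1 - min (X.d b a) (1 / 2)}

/-- The set `Z_a = {a} ∪ ⋃ {[a, a_b] \ {b} | b ≠ a}`. (Explicitly adding the vertex `a`, which lies
on every arc `[a, a_b]`, only matters when `X` has just one point.) -/
def fan (X : DistanceSpace.{u}) (a : X) : Set (OrientedGraph X) :=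
  {vertex a} ∪ ⋃ b ∈ {b : X | b ≠ a}, X.arc a b \ {vertex b}

/-- The underlying set of the cobweb. -/
def cobSet (X : DistanceSpace.{u}) : Set (OrientedGraph X) := ⋃ a : X, X.fan a

/-- The cobweb `Cob(X, d)` with the metric inherited from `(Γ(X), ρ)`, as a distance space. -/
noncomputable def cob (X : DistanceSpace.{u}) : DistanceSpace.{u} where
  carrier := X.cobSet
  d a b := rho a.1 b.1
  d_nonneg a b := rho_nonneg a.1 b.1
  d_self a := rho_self a.1

/-- The compression map `π : Cob(X, d) → X`. It is the map with `π(Z_a) = {a}`: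
see `compression_eq_iff`. -/
def compression (X : DistanceSpace.{u}) (z : X.cob) : X := start z.1

theorem start_of_mem_fan (X : DistanceSpace.{u}) {a : X} {z : OrientedGraph X}
    (hz : z ∈ X.fan a) : start z = a := by
  rcases hz with rfl | hz
  · rfl
  · simp only [Set.mem_iUnion] at hz
    obtain ⟨b, -, ⟨⟨h | ⟨_, t, ht, rfl⟩, -⟩, hb⟩⟩ := hz
    · rcases h with rfl | rfl
      · rfl
      · exact absurd rfl hb
    · rfl

theorem compression_eq_iff (X : DistanceSpace.{u}) (z : X.cob) (a : X) :
    X.compression z = a ↔ z.1 ∈ X.fan a := by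
  refine ⟨fun h => ?_, fun h => X.start_of_mem_fan h⟩
  obtain ⟨b, hb⟩ := Set.mem_iUnion.1 z.2
  have : start z.1 = b := X.start_of_mem_fan hb
  have hab : a = b := h.symm.trans this
  exact hab ▸ hb

/-- The iterated cobwebs: `Cob⁰(X, d) = (X, d)` and `Cobⁿ⁺¹(X, d) = Cob(Cobⁿ(X, d), ρₙ)`. -/
noncomputable def iterCob (X : DistanceSpace.{u}) : ℕ → DistanceSpace.{u}
  | 0 => X
  | n + 1 => (iterCob X n).cob

/-- The bonding compression map `πₙⁿ⁺¹ : Cobⁿ⁺¹(X, d) → Cobⁿ(X, d)`. -/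
noncomputable def bond (X : DistanceSpace.{u}) (n : ℕ) : X.iterCob (n + 1) → X.iterCob n :=
  (X.iterCob n).compression

/-- The inverse limit `Cob^ω(X, d)` of the spaces `Cobⁿ(X, d)`, `n ≥ 1`: the threads, with the
subspace topology of the product topology. The coordinate with index `n` here is the one in
`Cobⁿ⁺¹(X, d)`. -/
abbrev CobOmega (X : DistanceSpace.{u}) : Type u :=
  {x : (n : ℕ) → X.iterCob (n + 1) // ∀ n, X.bond (n + 1) (x (n + 1)) = x n}

/-- The limit projection `π₁^ω : Cob^ω(X, d) → Cob¹(X, d)`. -/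
def limitProjection (X : DistanceSpace.{u}) (x : X.CobOmega) : X.iterCob 1 := x.1 0

/-- The limit compression map `π₀^ω = π₀¹ ∘ π₁^ω : Cob^ω(X, d) → X`. -/
noncomputable def limitCompression (X : DistanceSpace.{u}) : X.CobOmega → X :=
  X.bond 0 ∘ X.limitProjection

end DistanceSpace

/-- A map between topological spaces is monotone if all its fibers are connected. -/
def IsMonotoneMap {A B : Type*} [TopologicalSpace A] [TopologicalSpace B] (f : A → B) : Prop :=
  ∀ y : B, IsConnected (f ⁻¹' {y})

/-- A map is hereditarily quotient if `y ∈ Int (f(U))` for each open `U ⊇ f⁻¹(y)`. -/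
def IsHereditarilyQuotient {A B : Type*} [TopologicalSpace A] [TopologicalSpace B]
    (f : A → B) : Prop :=
  ∀ (U : Set A) (y : B), IsOpen U → f ⁻¹' {y} ⊆ U → y ∈ interior (f '' U)

/-! The arc from `b` towards `a` is cut off at distance min(d(a,b), 1/2) from `a`. So for r ≤ 1/2
the r-ball about the vertex `a` in the cobweb compresses exactly onto the r-ball of X
(`compression_mem_ball`, `ball_subset_image_compression`), while near other points compression is
locally constant (`exists_ball_subset_fiber`). This gives continuity; fibers are stars of arcs,
hence connected.

Cobwebs are metric, so their balls are neighbourhoods and the later bonding maps are open at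
vertices. A thread continuing with vertices therefore has neighbourhoods projecting onto
neighbourhoods (`IsVertexThread.image_mem_nhds`). Over `a` in X only a ball is obtained: enough for
a quotient map, and for a hereditarily quotient one exactly when balls are neighbourhoods.

For monotonicity, a separation of a fiber is pushed up the levels through `exists_fiber_meets`,
until the limit thread contradicts it. -/

namespace OrientedGraph

variable {X : Type u}

/-! ### Chains and the path metric -/

theorem zero_mem_chainLengths (a : OrientedGraph X) : (0 : ℝ) ∈ chainLengths a a :=
  ⟨0, fun _ => a, rfl, rfl, by simp, by simp⟩

theorem chainLengths_snoc {a b c : OrientedGraph X} {L : ℝ} (hL : L ∈ chainLengths a b)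
    (h : SameEdge b c) : L + edgeDist b c ∈ chainLengths a c := by
  obtain ⟨n, f, h0, hn, hf, rfl⟩ := hL
  refine ⟨n + 1, fun i => if i ≤ n then f i else c, by simpa using h0, by simp, ?_, ?_⟩
  · intro i hi
    rcases Nat.lt_succ_iff_lt_or_eq.1 hi with hi | rfl
    · simpa [hi.le, Nat.succ_le_of_lt hi] using hf i hi
    · simpa [hn] using h
  · rw [Finset.sum_range_succ]
    congr 1
    · refine Finset.sum_congr rfl fun i hi => ?_
      have hi := Finset.mem_range.1 hi
      simp [hi.le, Nat.succ_le_of_lt hi]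
    · simp [hn]

theorem chainLengths_add {a b c : OrientedGraph X} {L M : ℝ} (hL : L ∈ chainLengths a b)
    (hM : M ∈ chainLengths b c) : L + M ∈ chainLengths a c := by
  obtain ⟨n, f, h0, hn, hf, rfl⟩ := hM
  induction n generalizing c with
  | zero => simpa [← hn, h0] using hL
  | succ n ih =>
    rw [Finset.sum_range_succ, ← add_assoc, ← hn]
    exact chainLengths_snoc (ih rfl fun i hi => hf i (hi.trans n.lt_succ_self)) (hf n n.lt_succ_self)

theorem SameEdge.symm {a b : OrientedGraph X} (h : SameEdge a b) : SameEdge b a := by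
  obtain ⟨x, y, hxy, ha, hb⟩ := h
  exact ⟨x, y, hxy, hb, ha⟩

theorem SameEdge.edgeDist_mem {a b : OrientedGraph X} (h : SameEdge a b) :
    edgeDist a b ∈ chainLengths a b := by
  simpa using chainLengths_snoc (zero_mem_chainLengths a) h

theorem SameEdge.rho_le {a b : OrientedGraph X} (h : SameEdge a b) : rho a b ≤ edgeDist a b :=
  csInf_le ⟨0, chainLengths_nonneg a b⟩ h.edgeDist_mem

theorem sameEdge_vertex {x y : X} (h : x ≠ y) : SameEdge (vertex x) (vertex y) :=
  ⟨x, y, h, by simp [edge], by simp [edge]⟩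

theorem edgePt_mem_edge (x y : X) (h : x ≠ y) (t : ℝ) (ht : t ∈ Set.Ioo (0 : ℝ) 1) :
    edgePt x y h t ht ∈ edge x y := Or.inr ⟨h, t, ht, rfl⟩

theorem chainLengths_start_nonempty (a : OrientedGraph X) :
    (chainLengths a (vertex a.start)).Nonempty ∧ (chainLengths (vertex a.start) a).Nonempty := by
  rcases a with x | ⟨x, y, h, t, ht⟩
  · exact ⟨⟨0, zero_mem_chainLengths _⟩, ⟨0, zero_mem_chainLengths _⟩⟩
  · have : SameEdge (vertex x) (edgePt x y h t ht) :=
      ⟨x, y, h, by simp [edge], edgePt_mem_edge ..⟩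
    exact ⟨⟨_, this.symm.edgeDist_mem⟩, ⟨_, this.edgeDist_mem⟩⟩

theorem chainLengths_nonempty (a b : OrientedGraph X) : (chainLengths a b).Nonempty := by
  obtain ⟨L, hL⟩ := (chainLengths_start_nonempty a).1
  obtain ⟨M, hM⟩ := (chainLengths_start_nonempty b).2
  by_cases h : a.start = b.start
  · exact ⟨_, chainLengths_add hL (h ▸ hM)⟩
  · exact ⟨_, chainLengths_add (chainLengths_snoc hL (sameEdge_vertex h)) hM⟩

theorem rho_triangle (a b c : OrientedGraph X) : rho a c ≤ rho a b + rho b c := by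
  refine le_of_forall_pos_le_add fun ε hε => ?_
  obtain ⟨L, hL, hL'⟩ := Real.lt_sInf_add_pos (chainLengths_nonempty a b) (half_pos hε)
  obtain ⟨M, hM, hM'⟩ := Real.lt_sInf_add_pos (chainLengths_nonempty b c) (half_pos hε)
  have : rho a c ≤ L + M := csInf_le ⟨0, chainLengths_nonneg a c⟩ (chainLengths_add hL hM)
  unfold rho at *
  linarith

/-- A function that is `1`-Lipschitz on every edge is `1`-Lipschitz for the path metric. -/
theorem sub_le_rho {f : OrientedGraph X → ℝ}
    (hf : ∀ a b, SameEdge a b → f b - f a ≤ edgeDist a b) (a b : OrientedGraph X) :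
    f b - f a ≤ rho a b := by
  refine le_csInf (chainLengths_nonempty a b) ?_
  rintro L ⟨n, c, rfl, rfl, hc, rfl⟩
  rw [← Finset.sum_range_sub (fun i => f (c i))]
  exact Finset.sum_le_sum fun i hi => hf _ _ (hc i (Finset.mem_range.1 hi))

open Classical in
/-- The distance to the vertex `a` within the edges incident to `a`, extended by `1`. -/
noncomputable def vertexDist (a : X) : OrientedGraph X → ℝ
  | vertex x => if x = a then 0 else 1
  | edgePt x y _ t _ => if x = a then t else if y = a then 1 - t else 1

theorem vertexDist_sub_le (a : X) (z w : OrientedGraph X) (h : SameEdge z w) :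
    vertexDist a w - vertexDist a z ≤ edgeDist z w := by
  obtain ⟨x, y, hxy, hz, hw⟩ := h
  rcases hz with (rfl | rfl) | ⟨_, t, ⟨ht0, ht1⟩, rfl⟩ <;>
  rcases hw with (rfl | rfl) | ⟨_, s, ⟨hs0, hs1⟩, rfl⟩ <;>
  simp only [vertexDist, edgeDist] <;>
  split_ifs <;> subst_vars <;> first | contradiction | skip
  all_goals first
    | linarith
    | (have := le_abs_self (t - s); have := neg_abs_le (t - s); linarith)

theorem vertexDist_le_rho (a : X) (z : OrientedGraph X) : vertexDist a z ≤ rho (vertex a) z := by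
  simpa [vertexDist] using sub_le_rho (vertexDist_sub_le a) (vertex a) z

open Classical in
/-- The distance from a point of the open edge `(a, b)` to the ends, extended by `0`. -/
noncomputable def edgeDepth (a b : X) : OrientedGraph X → ℝ
  | vertex _ => 0
  | edgePt x y _ t _ => if x = a ∧ y = b then min t (1 - t) else 0

theorem edgeDepth_sub_le (a b : X) (z w : OrientedGraph X) (h : SameEdge z w) :
    edgeDepth a b z - edgeDepth a b w ≤ edgeDist z w := by
  obtain ⟨x, y, hxy, hz, hw⟩ := h
  rcases hz with (rfl | rfl) | ⟨_, t, ⟨ht0, ht1⟩, rfl⟩ <;>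
  rcases hw with (rfl | rfl) | ⟨_, s, ⟨hs0, hs1⟩, rfl⟩ <;>
  simp only [edgeDepth, edgeDist] <;>
  split_ifs <;> first | contradiction | skip
  all_goals first
    | linarith
    | (have := min_le_left t (1 - t); have := min_le_right t (1 - t); linarith)
    | (have := le_min hs0.le (sub_nonneg.2 hs1.le); linarith)
    | (have := le_abs_self (t - s); have := neg_abs_le (t - s)
       have := min_le_left t (1 - t); have := min_le_right t (1 - t)
       rcases min_choice s (1 - s) with h | h <;> rw [h] <;> linarith)
    | (have := abs_nonneg (t - s); linarith)

/-- Depth in the open edge drops by at most the distance travelled, so it stays positive and the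
edge is never left. -/
theorem exists_eq_edgePt_of_rho_lt {a b : X} {h : a ≠ b} {t : ℝ} {ht : t ∈ Set.Ioo (0 : ℝ) 1}
    {w : OrientedGraph X} (hw : rho (edgePt a b h t ht) w < min t (1 - t)) :
    ∃ s hs, w = edgePt a b h s hs := by
  have key := sub_le_rho (f := fun z => - edgeDepth a b z)
    (fun z w hzw => by linarith [edgeDepth_sub_le a b z w hzw]) (edgePt a b h t ht) w
  have hdepth : edgeDepth a b (edgePt a b h t ht) = min t (1 - t) := by simp [edgeDepth]
  have hpos : 0 < edgeDepth a b w := by linarith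
  rcases w with x | ⟨x, y, hxy, s, hs⟩
  · simp [edgeDepth] at hpos
  · by_cases hx : x = a ∧ y = b
    · obtain ⟨rfl, rfl⟩ := hx
      exact ⟨s, hs, rfl⟩
    · simp [edgeDepth, hx] at hpos

theorem rho_vertex_edgePt (a b : X) (h : a ≠ b) (t : ℝ) (ht : t ∈ Set.Ioo (0 : ℝ) 1) :
    rho (vertex a) (edgePt a b h t ht) = t := by
  refine le_antisymm ?_ ?_
  · have : SameEdge (vertex a) (edgePt a b h t ht) :=
      ⟨a, b, h, by simp [edge], edgePt_mem_edge ..⟩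
    simpa [edgeDist] using this.rho_le
  · simpa [vertexDist] using vertexDist_le_rho a (edgePt a b h t ht)

theorem rho_vertex_edgePt_le (a b : X) (h : b ≠ a) (t : ℝ) (ht : t ∈ Set.Ioo (0 : ℝ) 1) :
    rho (vertex a) (edgePt b a h t ht) ≤ 1 - t := by
  have : SameEdge (vertex a) (edgePt b a h t ht) :=
    ⟨b, a, h, by simp [edge], edgePt_mem_edge ..⟩
  simpa [edgeDist, h.symm] using this.rho_le

open Classical in
/-- The parametrization of the half-open edge `[a, b] \ {b}` by `[0, 1)`. -/
noncomputable def edgeParam (a b : X) (h : a ≠ b) (t : ℝ) : OrientedGraph X :=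
  if ht : t ∈ Set.Ioo (0 : ℝ) 1 then edgePt a b h t ht else vertex a

theorem rho_edgeParam_le (a b : X) (h : a ≠ b) {s t : ℝ} (hs : s ∈ Set.Ico (0 : ℝ) 1)
    (ht : t ∈ Set.Ico (0 : ℝ) 1) :
    rho (edgeParam a b h s) (edgeParam a b h t) ≤ |s - t| := by
  have hp : ∀ r, edgeParam a b h r ∈ edge a b := fun r => by
    unfold edgeParam
    split_ifs
    · exact edgePt_mem_edge ..
    · simp [edge]
  have hst : SameEdge (edgeParam a b h s) (edgeParam a b h t) := ⟨a, b, h, hp s, hp t⟩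
  refine hst.rho_le.trans_eq ?_
  rcases hs.1.eq_or_lt with rfl | hs0 <;> rcases ht.1.eq_or_lt with rfl | ht0
  · simp [edgeParam, edgeDist]
  · simp [edgeParam, edgeDist, ht0, ht.2, abs_of_pos ht0]
  · simp [edgeParam, edgeDist, hs0, hs.2, abs_of_pos hs0]
  · simp [edgeParam, edgeDist, hs0, hs.2, ht0, ht.2]

end OrientedGraph

/-! ### Local structure of one compression map -/

namespace DistanceSpace

open OrientedGraph Topology

variable {X : DistanceSpace.{u}}

theorem ball_mono (x : X) {r s : ℝ} (h : r ≤ s) : X.ball x r ⊆ X.ball x s :=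
  fun _ hz => lt_of_lt_of_le (show X.d x _ < r from hz) h

theorem exists_ball_subset_of_mem_nhds {x : X} {U : Set X} (hU : U ∈ 𝓝 x) :
    ∃ r, 0 < r ∧ X.ball x r ⊆ U := by
  obtain ⟨V, hVU, hV, hx⟩ := mem_nhds_iff.1 hU
  obtain ⟨r, hr, h⟩ := hV x hx
  exact ⟨r, hr, h.trans hVU⟩

theorem WellBehaved.ball_mem_nhds (hX : X.WellBehaved) (x : X) {r : ℝ} (hr : 0 < r) :
    X.ball x r ∈ 𝓝 x := mem_interior_iff_mem_nhds.1 (hX x r hr)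

variable (X) in
theorem wellBehaved_cob : X.cob.WellBehaved := by
  intro x r hr
  have hopen : IsOpen (X.cob.ball x r) := by
    intro z hz
    have hz : rho x.1 z.1 < r := hz
    refine ⟨r - rho x.1 z.1, sub_pos.2 hz, fun w hw => ?_⟩
    have hw : rho z.1 w.1 < r - rho x.1 z.1 := hw
    show rho x.1 w.1 < r
    linarith [rho_triangle x.1 z.1 w.1]
  rw [hopen.interior_eq]
  exact (rho_self x.1).trans_lt hr

theorem vertex_mem_cobSet (a : X) : vertex a ∈ X.cobSet :=
  Set.mem_iUnion.2 ⟨a, Or.inl rfl⟩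

/-- The vertex `a` as a point of the cobweb. -/
def cobVertex (a : X) : X.cob := ⟨vertex a, vertex_mem_cobSet a⟩

@[simp] theorem compression_cobVertex (a : X) : X.compression (cobVertex a) = a := rfl

theorem edgePt_mem_cobSet {a b : X} {h : a ≠ b} {t : ℝ} {ht : t ∈ Set.Ioo (0 : ℝ) 1} :
    edgePt a b h t ht ∈ X.cobSet ↔ t ≤ 1 - min (X.d b a) (1 / 2) := by
  constructor
  · intro hz
    obtain ⟨c, hc⟩ := Set.mem_iUnion.1 hz
    rcases hc with hc | hc
    · cases hc
    · simp only [Set.mem_iUnion] at hc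
      obtain ⟨e, -, ⟨⟨he | ⟨_, _, _, he⟩, hr⟩, -⟩⟩ := hc
      · rcases he with he | he <;> cases he
      · cases he
        rwa [rho_vertex_edgePt] at hr
  · intro hle
    refine Set.mem_iUnion.2 ⟨a, Or.inr ?_⟩
    simp only [Set.mem_iUnion]
    exact ⟨b, h.symm, ⟨edgePt_mem_edge .., by rwa [rho_vertex_edgePt]⟩, by simp⟩

/-- Points of the cobweb close to the vertex `a` lie over points close to `a`. -/
theorem compression_mem_ball {a : X} {r : ℝ} (hr : r ≤ 1 / 2) {z : X.cob}
    (hz : z ∈ X.cob.ball (cobVertex a) r) : X.compression z ∈ X.ball a r := by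
  obtain ⟨z, hz'⟩ := z
  have hlt : vertexDist a z < r := (vertexDist_le_rho a z).trans_lt hz
  have h0 : 0 < r := (rho_nonneg _ _).trans_lt hz
  show X.d a (start z) < r
  rcases z with x | ⟨x, y, hxy, t, ht⟩
  · have : x = a := by
      by_contra hxa
      simp only [vertexDist, hxa, if_false] at hlt
      linarith
    simpa [start, this, X.d_self] using h0
  · by_cases hx : x = a
    · simpa [start, hx, X.d_self] using h0
    · by_cases hy : y = a
      · subst hy
        have hle := edgePt_mem_cobSet.1 hz'
        simp only [vertexDist, hx, if_false, if_true] at hlt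
        show X.d y x < r
        -- The cut-off gives min(d, 1/2) ≤ 1 - t < r ≤ 1/2, so the minimum is d.
        rcases min_choice (X.d y x) (1 / 2) with h | h <;> rw [h] at hle <;> linarith
      · simp only [vertexDist, hx, hy, if_false] at hlt
        linarith

/-- Every point close to `a` is the image of a point of the cobweb close to the vertex `a`. -/
theorem ball_subset_image_compression (a : X) {r : ℝ} (hr0 : 0 < r) (hr : r ≤ 1 / 2) :
    X.ball a r ⊆ X.compression '' X.cob.ball (cobVertex a) r := by
  intro b hb
  have hb : X.d a b < r := hb
  by_cases hba : b = a
  · subst hba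
    exact ⟨cobVertex b, (rho_self _).trans_lt hr0, rfl⟩
  · have hlt : max (X.d a b) (r / 2) < r := max_lt hb (half_lt_self hr0)
    have hpos : 0 < max (X.d a b) (r / 2) := lt_max_of_lt_right (half_pos hr0)
    have ht : 1 - max (X.d a b) (r / 2) ∈ Set.Ioo (0 : ℝ) 1 := ⟨by linarith, by linarith⟩
    refine ⟨⟨edgePt b a hba _ ht, edgePt_mem_cobSet.2 ?_⟩, ?_, rfl⟩
    · linarith [min_le_left (X.d a b) (1 / 2), le_max_left (X.d a b) (r / 2)]
    · exact (rho_vertex_edgePt_le a b hba _ ht).trans_lt (by linarith)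

theorem exists_ball_subset_image_compression {a : X} {W : Set X.cob} (hW : W ∈ 𝓝 (cobVertex a)) :
    ∃ r, 0 < r ∧ X.ball a r ⊆ X.compression '' W := by
  obtain ⟨r, hr, h⟩ := exists_ball_subset_of_mem_nhds hW
  have hpos : 0 < min r (1 / 2) := lt_min hr one_half_pos
  exact ⟨min r (1 / 2), hpos, (ball_subset_image_compression a hpos (min_le_right _ _)).trans
    (Set.image_mono ((ball_mono _ (min_le_left _ _)).trans h))⟩

theorem exists_ball_subset_fiber {z : X.cob} (hz : z ≠ cobVertex (X.compression z)) :
    ∃ r, 0 < r ∧ X.cob.ball z r ⊆ X.compression ⁻¹' {X.compression z} := by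
  obtain ⟨z, hz'⟩ := z
  rcases z with x | ⟨x, y, hxy, t, ht⟩
  · exact absurd rfl hz
  · refine ⟨min t (1 - t), lt_min ht.1 (sub_pos.2 ht.2), fun w hw => ?_⟩
    obtain ⟨s, hs, hws⟩ := exists_eq_edgePt_of_rho_lt (show rho _ w.1 < _ from hw)
    show start w.1 = x
    rw [hws]
    rfl

variable (X) in
theorem continuous_compression : Continuous X.compression := by
  refine ⟨fun E hE z hz => ?_⟩
  by_cases h : z = cobVertex (X.compression z)
  · obtain ⟨r, hr, hrE⟩ := hE _ hz
    refine ⟨min r (1 / 2), lt_min hr one_half_pos, fun w hw => hrE ?_⟩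
    rw [h] at hw
    exact ball_mono _ (min_le_left _ _) (compression_mem_ball (min_le_right _ _) hw)
  · obtain ⟨r, hr, hsub⟩ := exists_ball_subset_fiber h
    refine ⟨r, hr, fun w hw => ?_⟩
    have : X.compression w = X.compression z := hsub hw
    rwa [Set.mem_preimage, this]

/-- Every point of the fiber except its vertex is already interior to it; the ball is needed only
around the vertex. -/
theorem isOpen_fiber_union_ball (a : X) {r : ℝ} (hr : 0 < r) :
    IsOpen (X.compression ⁻¹' {a} ∪ interior (X.cob.ball (cobVertex a) r) : Set X.cob) := by
  have hball : ∀ w ∈ interior (X.cob.ball (cobVertex a) r), ∃ s : ℝ, 0 < s ∧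
      X.cob.ball w s ⊆ X.compression ⁻¹' {a} ∪ interior (X.cob.ball (cobVertex a) r) := by
    intro w hw
    have hO : IsOpen (interior (X.cob.ball (cobVertex a) r)) := isOpen_interior
    obtain ⟨s, hs, h⟩ := hO w hw
    exact ⟨s, hs, h.trans Set.subset_union_right⟩
  rintro z (hz | hz)
  · have hz : X.compression z = a := hz
    by_cases h : z = cobVertex (X.compression z)
    · rw [hz] at h
      exact hball z (h ▸ X.wellBehaved_cob _ r hr)
    · obtain ⟨s, hs, hsub⟩ := exists_ball_subset_fiber h
      rw [hz] at hsub
      exact ⟨s, hs, hsub.trans Set.subset_union_left⟩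
  · exact hball z hz

theorem isPreconnected_fiber_compression (a : X) :
    IsPreconnected (X.compression ⁻¹' {a}) := by
  refine isPreconnected_of_forall (cobVertex a) fun z hz => ?_
  obtain ⟨z, hz'⟩ := z
  have hz : start z = a := hz
  rcases z with x | ⟨x, y, hxy, t, ht⟩
  · obtain rfl : x = a := hz
    exact ⟨{cobVertex x}, by simp, rfl, rfl, isPreconnected_singleton⟩
  · obtain rfl : x = a := hz
    have hle := edgePt_mem_cobSet.1 hz'
    have hmem : ∀ s : Set.Icc (0 : ℝ) t, edgeParam x y hxy s ∈ X.cobSet := by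
      intro s
      unfold edgeParam
      split_ifs
      · exact edgePt_mem_cobSet.2 (s.2.2.trans hle)
      · exact vertex_mem_cobSet x
    let f : Set.Icc (0 : ℝ) t → X.cob := fun s => ⟨edgeParam x y hxy s, hmem s⟩
    have hf : Continuous f := by
      refine ⟨fun E hE => Metric.isOpen_iff.2 fun s hs => ?_⟩
      obtain ⟨r, hr, h⟩ := hE _ hs
      refine ⟨r, hr, fun s' hs' => h ?_⟩
      refine (rho_edgeParam_le x y hxy ⟨s.2.1, s.2.2.trans_lt ht.2⟩
        ⟨s'.2.1, s'.2.2.trans_lt ht.2⟩).trans_lt ?_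
      rw [Metric.mem_ball, dist_comm, Subtype.dist_eq, Real.dist_eq] at hs'
      exact hs'
    have : PreconnectedSpace (Set.Icc (0 : ℝ) t) :=
      isPreconnected_iff_preconnectedSpace.1 isPreconnected_Icc
    refine ⟨Set.range f, ?_, ⟨⟨0, le_rfl, ht.1.le⟩, ?_⟩, ⟨⟨t, ht.1.le, le_rfl⟩, ?_⟩,
      isPreconnected_range hf⟩
    · rintro _ ⟨s, rfl⟩
      show start (edgeParam x y hxy s) = x
      unfold edgeParam
      split_ifs <;> rfl
    · apply Subtype.ext
      simp [f, edgeParam, cobVertex]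
    · apply Subtype.ext
      simp [f, edgeParam, ht.1, ht.2]

/-! ### Threads and limit projections -/

variable (X) in
theorem continuous_bond (n : ℕ) : Continuous (X.bond n) := (X.iterCob n).continuous_compression

/-- The vertex section of the bonding map. -/
noncomputable def iterVertex (n : ℕ) (y : X.iterCob n) : X.iterCob (n + 1) :=
  cobVertex (X := X.iterCob n) y

@[simp] theorem bond_iterVertex (n : ℕ) (y : X.iterCob n) : X.bond n (iterVertex n y) = y := rfl

/-- The target index is `n + 1` because balls are neighbourhoods in a cobweb, but perhaps not in
`X`. -/
theorem image_bond_mem_nhds {n : ℕ} {y : X.iterCob (n + 1)} {W : Set (X.iterCob (n + 2))}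
    (hW : W ∈ 𝓝 (iterVertex (n + 1) y)) : X.bond (n + 1) '' W ∈ 𝓝 y := by
  obtain ⟨r, hr, h⟩ := exists_ball_subset_image_compression (X := X.iterCob (n + 1)) hW
  exact Filter.mem_of_superset ((X.iterCob n).wellBehaved_cob.ball_mem_nhds y hr) h

theorem CobOmega.eq_of_le {x y : X.CobOmega} {n : ℕ} (h : x.1 n = y.1 n) {m : ℕ} (hm : m ≤ n) :
    x.1 m = y.1 m := by
  induction n with
  | zero => rwa [Nat.le_zero.1 hm]
  | succ n ih =>
    rcases hm.eq_or_lt with rfl | hm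
    · exact h
    · exact ih (by rw [← x.2 n, ← y.2 n, h]) (Nat.lt_succ_iff.1 hm)

/-- A thread that continues with vertices after the coordinate `n`. -/
def IsVertexThread (n : ℕ) (x : X.CobOmega) : Prop :=
  ∀ m, n ≤ m → x.1 (m + 1) = iterVertex (m + 1) (x.1 m)

theorem exists_isVertexThread (n : ℕ) (y : X.iterCob (n + 1)) :
    ∃ x : X.CobOmega, x.1 n = y ∧ IsVertexThread n x := by
  induction n with
  | zero =>
    exact ⟨⟨fun m => Nat.rec (motive := fun m => X.iterCob (m + 1)) y
      (fun m z => iterVertex (m + 1) z) m, fun _ => rfl⟩, rfl, fun _ _ => rfl⟩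
  | succ n ih =>
    obtain ⟨x, hxn, -⟩ := ih (X.bond (n + 1) y)
    -- Splice: `x` up to index `n`, then `y`, then vertices forever.
    let g : ∀ m, X.iterCob (m + 1) := fun m => Nat.rec (motive := fun m => X.iterCob (m + 1)) (x.1 0)
      (fun m z => if m + 1 ≤ n + 1 then Function.update x.1 (n + 1) y (m + 1)
        else iterVertex (m + 1) z) m
    have hsucc : ∀ m, g (m + 1) = if m + 1 ≤ n + 1 then Function.update x.1 (n + 1) y (m + 1)
        else iterVertex (m + 1) (g m) := fun _ => rfl
    have hle : ∀ m ≤ n, g m = x.1 m := by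
      intro m hm
      cases m with
      | zero => rfl
      | succ m => rw [hsucc, if_pos (by omega), Function.update_of_ne (by omega)]
    have hy : g (n + 1) = y := by rw [hsucc, if_pos le_rfl, Function.update_self]
    refine ⟨⟨g, fun m => ?_⟩, hy, fun m hm => ?_⟩
    · rcases lt_trichotomy m n with h | rfl | h
      · rw [hle m h.le, hle (m + 1) h, x.2]
      · rw [hy, hle m le_rfl, hxn]
      · rw [hsucc, if_neg (by omega), bond_iterVertex]
    · show g (m + 1) = _
      rw [hsucc, if_neg (by omega)]

/-- Continuity of the bonds makes conditions on later coordinates finer, so a single coordinate, as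
late as desired, determines a basic neighbourhood. -/
theorem exists_mem_nhds_of_mem_nhds_cobOmega {x : X.CobOmega} {U : Set X.CobOmega}
    (hU : U ∈ 𝓝 x) (n : ℕ) :
    ∃ k, ∃ W ∈ 𝓝 (x.1 (n + k)), ∀ u : X.CobOmega, u.1 (n + k) ∈ W → u ∈ U := by
  have hanti : Antitone fun i => Filter.comap (fun u : X.CobOmega => u.1 i) (𝓝 (x.1 i)) := by
    refine antitone_nat_of_succ_le fun i => ?_
    have h1 : Filter.Tendsto (X.bond (i + 1)) (𝓝 (x.1 (i + 1))) (𝓝 (x.1 i)) := by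
      have := (X.continuous_bond (i + 1)).tendsto (x.1 (i + 1))
      rwa [x.2 i] at this
    have h2 : (fun u : X.CobOmega => u.1 i) = X.bond (i + 1) ∘ fun u => u.1 (i + 1) :=
      funext fun u => (u.2 i).symm
    rw [h2, ← Filter.comap_comap]
    exact Filter.comap_mono (Filter.map_le_iff_le_comap.1 h1)
  rw [show 𝓝 x = Filter.comap Subtype.val (𝓝 x.1) from nhds_induced _ _, nhds_pi, Filter.pi,
    Filter.comap_iInf] at hU
  simp only [Filter.comap_comap] at hU
  obtain ⟨i, hi⟩ := (Filter.mem_iInf_of_directed hanti.directed_ge U).1 hU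
  obtain ⟨W, hW, hWU⟩ := hanti (Nat.le_add_left i n) hi
  exact ⟨i, W, hW, fun u hu => hWU hu⟩

/-- The limit projections are open at threads which eventually consist of vertices. -/
theorem IsVertexThread.image_mem_nhds {n : ℕ} {x : X.CobOmega} (hx : IsVertexThread n x)
    {U : Set X.CobOmega} (hU : U ∈ 𝓝 x) : (fun u : X.CobOmega => u.1 n) '' U ∈ 𝓝 (x.1 n) := by
  have key : ∀ k, ∀ W ∈ 𝓝 (x.1 (n + k)),
      (fun u : X.CobOmega => u.1 n) '' {u | u.1 (n + k) ∈ W} ∈ 𝓝 (x.1 n) := by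
    intro k
    induction k with
    | zero =>
      intro W hW
      refine Filter.mem_of_superset hW fun w hw => ?_
      obtain ⟨u, hu, -⟩ := exists_isVertexThread n w
      exact ⟨u, by simpa [hu] using hw, hu⟩
    | succ k ih =>
      intro W hW
      have hW' : W ∈ 𝓝 (iterVertex (n + k + 1) (x.1 (n + k))) := by
        rw [← hx (n + k) (Nat.le_add_right n k)]
        exact hW
      refine Filter.mem_of_superset (ih _ (image_bond_mem_nhds hW')) ?_
      rintro _ ⟨u, ⟨w, hw, hwu⟩, rfl⟩
      obtain ⟨v, hv, -⟩ := exists_isVertexThread (n + k + 1) w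
      refine ⟨v, show v.1 (n + k + 1) ∈ W from hv ▸ hw, ?_⟩
      refine CobOmega.eq_of_le (n := n + k) ?_ (Nat.le_add_right n k)
      rw [← v.2, hv, hwu]
  obtain ⟨k, W, hW, hWU⟩ := exists_mem_nhds_of_mem_nhds_cobOmega hU n
  exact Filter.mem_of_superset (key k W hW) (Set.image_mono fun u hu => hWU u hu)

/-! ### The limit compression map -/

theorem exists_ball_subset_image_limitCompression (a : X) :
    ∃ x : X.CobOmega, X.limitCompression x = a ∧ ∀ U ∈ 𝓝 x,
      ∃ r, 0 < r ∧ X.ball a r ⊆ X.limitCompression '' U := by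
  obtain ⟨x, hx0, hx⟩ := exists_isVertexThread 0 (iterVertex 0 a)
  refine ⟨x, congrArg (X.bond 0) hx0, fun U hU => ?_⟩
  have h := hx.image_mem_nhds hU
  rw [hx0] at h
  obtain ⟨r, hr, hsub⟩ := exists_ball_subset_image_compression (X := X) h
  refine ⟨r, hr, hsub.trans ?_⟩
  rintro _ ⟨_, ⟨u, hu, rfl⟩, rfl⟩
  exact ⟨u, hu, rfl⟩

variable (X) in
theorem continuous_limitCompression : Continuous X.limitCompression :=
  (X.continuous_bond 0).comp ((continuous_apply 0).comp continuous_subtype_val)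

variable (X) in
theorem surjective_limitCompression : Function.Surjective X.limitCompression := fun a =>
  let ⟨x, hx, _⟩ := exists_ball_subset_image_limitCompression a
  ⟨x, hx⟩

variable (X) in
theorem isQuotientMap_limitCompression : IsQuotientMap X.limitCompression := by
  refine ⟨isCoinducing_iff.2 fun A => ⟨fun hA a ha => ?_,
    fun hA => hA.preimage X.continuous_limitCompression⟩, X.surjective_limitCompression⟩
  obtain ⟨x, hx, h⟩ := exists_ball_subset_image_limitCompression a
  obtain ⟨r, hr, hsub⟩ := h _ (hA.mem_nhds (show X.limitCompression x ∈ A by rwa [hx]))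
  exact ⟨r, hr, hsub.trans (Set.image_preimage_subset _ _)⟩

/-- If two open sets separate the preimage of a preconnected set under a limit projection, then
they separate the preimage of some point of this set. -/
theorem exists_fiber_meets {n : ℕ} {S : Set (X.iterCob (n + 1))} (hS : IsPreconnected S)
    {U V : Set X.CobOmega} (hU : IsOpen U) (hV : IsOpen V)
    (hUV : ∀ u : X.CobOmega, u.1 n ∈ S → u ∈ U ∪ V)
    (hmU : ∃ u ∈ U, u.1 n ∈ S) (hmV : ∃ v ∈ V, v.1 n ∈ S) :
    ∃ z ∈ S, (∃ u ∈ U, u.1 n = z) ∧ ∃ v ∈ V, v.1 n = z := by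
  let p : X.CobOmega → X.iterCob (n + 1) := fun u => u.1 n
  by_contra hcon
  push Not at hcon
  -- Each point of `S` carries a vertex thread, lying in `U` or `V`, where the projection is open.
  have hcover : S ⊆ interior (p '' U) ∪ interior (p '' V) := by
    intro z hz
    obtain ⟨x, hxz, hx⟩ := exists_isVertexThread n z
    rcases hUV x (hxz ▸ hz) with h | h
    · exact Or.inl (mem_interior_iff_mem_nhds.2 (hxz ▸ hx.image_mem_nhds (hU.mem_nhds h)))
    · exact Or.inr (mem_interior_iff_mem_nhds.2 (hxz ▸ hx.image_mem_nhds (hV.mem_nhds h)))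
  have hdisj : ∀ z ∈ S, z ∈ p '' U → z ∈ p '' V → False := by
    rintro z hz ⟨u, hu, huz⟩ ⟨v, hv, hvz⟩
    exact hcon z hz ⟨u, hu, huz⟩ v hv hvz
  obtain ⟨u, hu, huS⟩ := hmU
  obtain ⟨v, hv, hvS⟩ := hmV
  have h1 : p u ∈ interior (p '' U) := (hcover huS).resolve_right fun h =>
    hdisj _ huS ⟨u, hu, rfl⟩ (interior_subset h)
  have h2 : p v ∈ interior (p '' V) := (hcover hvS).resolve_left fun h =>
    hdisj _ hvS (interior_subset h) ⟨v, hv, rfl⟩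
  obtain ⟨z, hz, hzU, hzV⟩ := hS _ _ isOpen_interior isOpen_interior hcover
    ⟨_, huS, h1⟩ ⟨_, hvS, h2⟩
  exact hdisj z hz (interior_subset hzU) (interior_subset hzV)

variable (X) in
theorem isMonotoneMap_limitCompression : IsMonotoneMap X.limitCompression := by
  intro a
  obtain ⟨x, hx⟩ := X.surjective_limitCompression a
  refine ⟨⟨x, hx⟩, fun U V hU hV hUV ⟨u, huF, huU⟩ ⟨v, hvF, hvV⟩ => ?_⟩
  by_contra hne
  have hdisj : ∀ w ∈ X.limitCompression ⁻¹' {a}, w ∈ U → w ∈ V → False :=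
    fun w hw hwU hwV => hne ⟨w, hw, hwU, hwV⟩
  -- `Q n z`: both `U` and `V` contain threads of the fiber of `a` passing through `z`. Connected
  -- bond fibers lift this to the next level.
  let Q : ∀ n, X.iterCob (n + 1) → Prop := fun n z =>
    (∃ u ∈ U, u.1 n = z ∧ X.limitCompression u = a) ∧ ∃ v ∈ V, v.1 n = z ∧ X.limitCompression v = a
  have hfib : ∀ n z, Q n z → ∀ w : X.CobOmega, w.1 n = z → X.limitCompression w = a := by
    rintro n z ⟨⟨u, -, huz, hua⟩, -⟩ w hw
    rw [← hua]
    exact congrArg (X.bond 0) (CobOmega.eq_of_le (hw.trans huz.symm) (Nat.zero_le n))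
  have h0 : ∃ z, Q 0 z := by
    obtain ⟨z, hz, ⟨u, hu, huz⟩, ⟨v, hv, hvz⟩⟩ := exists_fiber_meets (n := 0)
      (isPreconnected_fiber_compression (X := X) a) hU hV (fun w hw => hUV hw)
      ⟨u, huU, huF⟩ ⟨v, hvV, hvF⟩
    refine ⟨z, ⟨u, hu, huz, ?_⟩, ⟨v, hv, hvz, ?_⟩⟩
    · exact (congrArg (X.bond 0) huz).trans hz
    · exact (congrArg (X.bond 0) hvz).trans hz
  have hstep : ∀ n z, Q n z → ∃ z', X.bond (n + 1) z' = z ∧ Q (n + 1) z' := by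
    intro n z hQ
    have hF := hfib n z hQ
    obtain ⟨⟨u, hu, huz, -⟩, ⟨v, hv, hvz, -⟩⟩ := hQ
    obtain ⟨z', hz', ⟨u', hu', huz'⟩, ⟨v', hv', hvz'⟩⟩ := exists_fiber_meets (n := n + 1)
      (isPreconnected_fiber_compression (X := X.iterCob (n + 1)) z) hU hV
      (fun w hw => hUV (hF w ((w.2 n).symm.trans hw)))
      ⟨u, hu, (u.2 n).trans huz⟩ ⟨v, hv, (v.2 n).trans hvz⟩
    have hz' : X.bond (n + 1) z' = z := hz'
    exact ⟨z', hz', ⟨u', hu', huz', hF u' (by rw [← u'.2 n, huz', hz'])⟩,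
      ⟨v', hv', hvz', hF v' (by rw [← v'.2 n, hvz', hz'])⟩⟩
  choose next hnext hQnext using hstep
  let s : ∀ n, {z : X.iterCob (n + 1) // Q n z} := fun n =>
    Nat.rec (motive := fun n => {z : X.iterCob (n + 1) // Q n z}) ⟨h0.choose, h0.choose_spec⟩
      (fun n z => ⟨next n z.1 z.2, hQnext n z.1 z.2⟩) n
  let t : X.CobOmega := ⟨fun n => (s n).1, fun n => hnext n (s n).1 (s n).2⟩
  have htF : X.limitCompression t = a := hfib 0 _ (s 0).2 t rfl
  -- A neighbourhood of `t` inside one open set is given by one coordinate, through which a thread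
  -- of the other set also passes.
  rcases hUV htF with h | h
  · obtain ⟨k, W, hW, hWU⟩ := exists_mem_nhds_of_mem_nhds_cobOmega (hU.mem_nhds h) 0
    obtain ⟨-, ⟨v, hv, hvt, hva⟩⟩ := (s (0 + k)).2
    exact hdisj v hva (hWU v (by rw [hvt]; exact mem_of_mem_nhds hW)) hv
  · obtain ⟨k, W, hW, hWV⟩ := exists_mem_nhds_of_mem_nhds_cobOmega (hV.mem_nhds h) 0
    obtain ⟨⟨u, hu, hut, hua⟩, -⟩ := (s (0 + k)).2
    exact hdisj u hua hu (hWV u (by rw [hut]; exact mem_of_mem_nhds hW))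

variable (X) in
theorem isHereditarilyQuotient_limitCompression_iff :
    IsHereditarilyQuotient X.limitCompression ↔ X.WellBehaved := by
  constructor
  · intro h a r hr
    have hpos : 0 < min r (1 / 2) := lt_min hr one_half_pos
    have hO := isOpen_fiber_union_ball a hpos
    have hp : Continuous X.limitProjection := (continuous_apply 0).comp continuous_subtype_val
    refine interior_mono ?_ (h _ a (hO.preimage hp) fun u hu => Or.inl hu)
    -- The open set from `isOpen_fiber_union_ball` compresses into the r-ball of `a`.
    rintro _ ⟨u, hu | hu, rfl⟩
    · have hu : X.limitCompression u = a := hu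
      rw [hu]
      exact (X.d_self a).trans_lt hr
    · exact ball_mono a (min_le_left _ _)
        (compression_mem_ball (min_le_right _ _) (interior_subset hu))
  · intro hX U a hU hsub
    obtain ⟨x, hx, h⟩ := exists_ball_subset_image_limitCompression a
    obtain ⟨r, hr, hr'⟩ := h U (hU.mem_nhds (hsub hx))
    exact interior_mono hr' (hX a r hr)

end DistanceSpace

theorem mainTheorem7 (X : DistanceSpace.{u}) :
    (Continuous X.limitCompression ∧
      IsMonotoneMap X.limitCompression ∧
      Topology.IsQuotientMap X.limitCompression ∧
      Function.Surjective X.limitCompression) ∧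
    (IsHereditarilyQuotient X.limitCompression ↔ X.WellBehaved) :=
  ⟨⟨X.continuous_limitCompression, X.isMonotoneMap_limitCompression,
    X.isQuotientMap_limitCompression, X.surjective_limitCompression⟩,
    X.isHereditarilyQuotient_limitCompression_iff⟩
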